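/- For a primitive matrix $B$ with entries in $\{0,1,2,\dots\}$ (that is, a square matrix of positive size some power of which has all entries positive), let $\lambda_B$ be its Perron–Frobenius eigenvalue (the spectral radius), let $x=(x_1,\dots,x_m)^T$ be its normalized Perron–Frobenius eigenvector (so $Bx=\lambda_B x$, all $x_i>0$ and $\sum_i x_i=1$), let $H(x)$ be the additive subgroup of $\mathbb{R}$ generated by $x_1,\dots,x_m$, and put $S(B)=\bigcup_{N=0}^{\infty}\lambda_B^{-N}H(x)\subset\mathbb{R}$. Let $A$ be a primitive $s\times s$ matrix with entries in $\{0,1,2,\dots\}$, let $\lambda=\lambda_A$, and let $k$ be the degree of the algebraic number $\lambda$ over $\mathbb{Q}$. Suppose $k\ge 2$. Then there exist a primitive $k\times k$ matrix $\widetilde A$ with entries in $\{0,1,2,\dots\}$ and a positive number $\alpha\in\mathbb{Q}(\lambda)$ such that $S(\widetilde A)=\alpha S(A)$. Moreover, $k$ is the least possible dimension: if $P$ is a primitive $l\times l$ matrix with entries in $\{0,1,2,\dots\}$ and $S(P)=\alpha S(A)$ for some $\alpha\in\mathbb{R}$, then $l\ge k$. -/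

import Mathlib

open scoped Pointwise

noncomputable section

namespace PerronClopen

/-- A square matrix with entries in `ℕ = {0, 1, 2, …}` is primitive if some positive power of it
is entrywise strictly positive. -/
def Primitive {s : ℕ} (A : Matrix (Fin s) (Fin s) ℕ) : Prop :=
  (A.map (fun n : ℕ => (n : ℝ))).IsPrimitive

/-- The Perron–Frobenius eigenvalue of a nonnegative matrix: its spectral radius, i.e. the largest
absolute value of a complex eigenvalue. -/
def perronRoot {s : ℕ} (A : Matrix (Fin s) (Fin s) ℕ) : ℝ :=
  (spectralRadius ℂ (A.map (fun n : ℕ => (n : ℂ)))).toReal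

/-- `x` is a normalized Perron–Frobenius eigenvector of `A`: an eigenvector for the
Perron–Frobenius eigenvalue with positive coordinates of sum `1`.
For a primitive matrix of positive size there is exactly one. -/
structure IsNormalizedPerronVector {s : ℕ} (A : Matrix (Fin s) (Fin s) ℕ) (x : Fin s → ℝ) :
    Prop where
  pos : ∀ i, 0 < x i
  eigen : (A.map (fun n : ℕ => (n : ℝ))).mulVec x = perronRoot A • x
  sum_eq_one : ∑ i, x i = 1

/-- The additive subgroup `H(x)` of `ℝ` generated by the coordinates of `x`. -/
def H {s : ℕ} (x : Fin s → ℝ) : AddSubgroup ℝ :=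
  AddSubgroup.closure (Set.range x)

/-- `S(A) = ⋃_{N ≥ 0} λ^{-N} H(x)`, where `λ` is the Perron–Frobenius eigenvalue of `A` and `x` is
the normalized Perron–Frobenius eigenvector (the outer union only introduces this unique `x`). -/
def S {s : ℕ} (A : Matrix (Fin s) (Fin s) ℕ) : Set ℝ :=
  ⋃ (x : Fin s → ℝ) (_ : IsNormalizedPerronVector A x) (N : ℕ),
    (1 / perronRoot A ^ N) • (H x : Set ℝ)

end PerronClopen

end

/-!
Let `x` be the normalized Perron–Frobenius eigenvector of `A`. Its coordinates lie in `ℚ(λ)`, and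
`H(x)` is stable under multiplication by `λ`, so `ℚ·x₁ + ⋯ + ℚ·xₛ` is a nonzero `ℚ(λ)`-subspace of
`ℚ(λ)`. Hence `H(x)` is a free abelian group of rank `k`, and `S(A)` spans a `ℚ`-space of
dimension `k`, whereas `S(P)` spans one of dimension at most `l`.

By a theorem of Elliott on totally ordered groups, repeatedly replacing a generator by its
difference with a smaller one turns `x` into a basis `y` of `H(x)` that consists of positive numbers
and has every `xⱼ` as a nonnegative integer combination. On the other hand, if `h` is an integer
vector with `h·x > 0`, then for large `N` the coefficients `h Aᴺ` of `λᴺ (h·x)` are positive, since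
the columns of `Aᴺ` become parallel to `x`. Applied to the coefficients of each `yᵢ`, this writes
`λᵉ yᵢ` as a positive combination of the `xⱼ`, hence of the `yᵢ`, for some `e > 0`. So `λᵉ` acts
on `y` by a positive integer matrix, which is the required one, with `α = 1 / ∑ yᵢ`.
-/

namespace PerronClopen

open Matrix Filter

/-! ### Perron–Frobenius theory -/

section PerronFrobenius

variable {n : Type*} [Fintype n]

theorem pow_mulVec_of_mulVec_eq_smul [DecidableEq n] {R : Type*} [CommSemiring R]
    {M : Matrix n n R} {x : n → R} {t : R} (h : M *ᵥ x = t • x) (N : ℕ) :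
    (M ^ N) *ᵥ x = t ^ N • x := by
  induction N with
  | zero => simp
  | succ N ih => rw [pow_succ, ← mulVec_mulVec, h, mulVec_smul, ih, smul_smul, pow_succ']

theorem exists_mulVec_eq_smul_iff_isRoot_charpoly [DecidableEq n] {K : Type*} [Field K]
    {M : Matrix n n K} {t : K} : (∃ v ≠ 0, M *ᵥ v = t • v) ↔ M.charpoly.IsRoot t := by
  rw [Polynomial.IsRoot.def, eval_charpoly, ← exists_mulVec_eq_zero_iff]
  refine exists_congr fun v => and_congr_right fun _ => ?_
  rw [sub_mulVec, sub_eq_zero, scalar_apply, ← smul_one_eq_diagonal, smul_mulVec, one_mulVec,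
    eq_comm]

theorem mulVec_pos_of_pos {R : Type*} [Semiring R] [PartialOrder R] [IsStrictOrderedRing R]
    {M : Matrix n n R} (hM : ∀ i j, 0 < M i j) {u : n → R} (hu : 0 ≤ u) (hu0 : u ≠ 0) (i : n) :
    0 < (M *ᵥ u) i := by
  obtain ⟨j, hj⟩ := Function.ne_iff.mp hu0
  exact Finset.sum_pos' (fun k _ => mul_nonneg (hM i k).le (hu k))
    ⟨j, Finset.mem_univ j, mul_pos (hM i j) ((hu j).lt_of_ne' hj)⟩

/-- The pairs `(t, p)` of a number `t ≥ 0` and a probability vector `p` with `t p ≤ M p`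
entrywise. The Perron–Frobenius eigenvalue is the largest first component of such a pair
(Collatz–Wielandt). -/
def subinvariantPairs (M : Matrix n n ℝ) : Set (ℝ × (n → ℝ)) :=
  {q | 0 ≤ q.1 ∧ q.2 ∈ stdSimplex ℝ n ∧ q.1 • q.2 ≤ M *ᵥ q.2}

theorem isCompact_subinvariantPairs {M : Matrix n n ℝ} (hM : ∀ i j, 0 ≤ M i j) :
    IsCompact (subinvariantPairs M) := by
  have hclosed : IsClosed (subinvariantPairs M) :=
    (isClosed_le continuous_const continuous_fst).inter
      (((isClosed_stdSimplex ℝ n).preimage continuous_snd).inter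
        (isClosed_le (f := fun q : ℝ × (n → ℝ) => q.1 • q.2) (g := fun q => M *ᵥ q.2)
          (by fun_prop) (by fun_prop)))
  have hcompact : IsCompact (Set.Icc 0 (∑ i, ∑ j, M i j) ×ˢ stdSimplex ℝ n) :=
    isCompact_Icc.prod (isCompact_stdSimplex ℝ n)
  refine hcompact.of_isClosed_subset hclosed ?_
  rintro ⟨t, p⟩ ⟨ht, hp, h⟩
  refine ⟨⟨ht, ?_⟩, hp⟩
  calc t = ∑ i, t * p i := by rw [← Finset.mul_sum, hp.2, mul_one]
    _ ≤ ∑ i, (M *ᵥ p) i := Finset.sum_le_sum fun i _ => h i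
    _ ≤ ∑ i, ∑ j, M i j := Finset.sum_le_sum fun i _ => Finset.sum_le_sum fun j _ =>
      mul_le_of_le_one_right (hM i j) (mem_Icc_of_mem_stdSimplex hp j).2

theorem subinvariantPairs_nonempty [Nonempty n] {M : Matrix n n ℝ} (hM : ∀ i j, 0 ≤ M i j) :
    (subinvariantPairs M).Nonempty := by
  classical
  obtain ⟨i⟩ := ‹Nonempty n›
  refine ⟨(0, Pi.single i 1), le_rfl, single_mem_stdSimplex ℝ i, fun j => ?_⟩
  simpa using hM j i

theorem exists_mem_subinvariantPairs_lt [Nonempty n] {M : Matrix n n ℝ} {t : ℝ} (ht : 0 ≤ t)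
    {q : n → ℝ} (hq : ∀ i, 0 < q i) (h : ∀ i, t * q i < (M *ᵥ q) i) :
    ∃ r ∈ subinvariantPairs M, t < r.1 := by
  obtain ⟨i₀, hi₀⟩ := Finite.exists_min fun i => (M *ᵥ q) i / q i
  set e := (M *ᵥ q) i₀ / q i₀
  have hte : t < e := (lt_div_iff₀ (hq i₀)).mpr (h i₀)
  have heq : e • q ≤ M *ᵥ q := fun i => (le_div_iff₀ (hq i)).mp (hi₀ i)
  have hsum : 0 < ∑ i, q i := Finset.sum_pos (fun i _ => hq i) Finset.univ_nonempty
  refine ⟨(e, (∑ i, q i)⁻¹ • q), ⟨ht.trans hte.le, ⟨fun i => ?_, ?_⟩, ?_⟩, hte⟩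
  · exact mul_nonneg (inv_nonneg.mpr hsum.le) (hq i).le
  · simp only [Pi.smul_apply, smul_eq_mul, ← Finset.mul_sum]
    exact inv_mul_cancel₀ hsum.ne'
  · rw [mulVec_smul, smul_comm]
    exact smul_le_smul_of_nonneg_left heq (inv_nonneg.mpr hsum.le)

theorem exists_pos_eigenvector [DecidableEq n] [Nonempty n] {M : Matrix n n ℝ}
    (hM : M.IsPrimitive) :
    ∃ (t : ℝ) (x : n → ℝ), (∀ i, 0 < x i) ∧ ∑ i, x i = 1 ∧ M *ᵥ x = t • x := by
  obtain ⟨hM0, m, -, hm⟩ := hM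
  obtain ⟨⟨t, p⟩, ⟨ht, hp, hle⟩, hmax⟩ := (isCompact_subinvariantPairs hM0).exists_isMaxOn
    (subinvariantPairs_nonempty hM0) continuous_fst.continuousOn
  have hqpos : ∀ i, 0 < ((M ^ m) *ᵥ p) i := by
    refine mulVec_pos_of_pos hm hp.1 ?_
    rintro rfl
    simpa using hp.2
  -- Otherwise `M ^ m` maps the nonzero defect `M p - t p ≥ 0` to a strictly positive vector, so
  -- that `M ^ m p` admits a number larger than `t`.
  have heig : M *ᵥ p = t • p := by
    by_contra hne
    have hpos := mulVec_pos_of_pos hm (sub_nonneg.mpr hle) (sub_ne_zero.mpr hne)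
    have hcomm : (M ^ m) *ᵥ (M *ᵥ p - t • p) = M *ᵥ ((M ^ m) *ᵥ p) - t • ((M ^ m) *ᵥ p) := by
      rw [mulVec_sub, mulVec_smul, mulVec_mulVec, mulVec_mulVec, ← pow_succ, ← pow_succ']
    rw [hcomm] at hpos
    obtain ⟨r, hr, htr⟩ :=
      exists_mem_subinvariantPairs_lt ht hqpos fun i => sub_pos.mp (hpos i)
    exact (hmax hr).not_gt htr
  refine ⟨t, p, fun i => ?_, hp.2, heig⟩
  have := hqpos i
  rw [pow_mulVec_of_mulVec_eq_smul heig] at this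
  exact pos_of_mul_pos_right this (pow_nonneg ht m)

theorem eq_smul_of_mulVec_eq_smul [DecidableEq n] [Nonempty n] {M : Matrix n n ℝ}
    (hM : M.IsPrimitive) {t : ℝ} {x v : n → ℝ} (hx : ∀ i, 0 < x i) (hMx : M *ᵥ x = t • x)
    (hMv : M *ᵥ v = t • v) : ∃ c : ℝ, v = c • x := by
  obtain ⟨-, m, -, hm⟩ := hM
  obtain ⟨i₀, hi₀⟩ := Finite.exists_min fun i => v i / x i
  set c := v i₀ / x i₀
  have hnonneg : 0 ≤ v - c • x := fun i =>
    sub_nonneg.mpr ((le_div_iff₀ (hx i)).mp (hi₀ i))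
  have heig : M *ᵥ (v - c • x) = t • (v - c • x) := by
    rw [mulVec_sub, mulVec_smul, hMx, hMv, smul_sub, smul_comm]
  have hzero : (v - c • x) i₀ = 0 :=
    sub_eq_zero.mpr (div_mul_cancel₀ _ (hx i₀).ne').symm
  refine ⟨c, sub_eq_zero.mp ?_⟩
  by_contra hne
  have hpos := mulVec_pos_of_pos hm hnonneg hne i₀
  rw [pow_mulVec_of_mulVec_eq_smul heig, Pi.smul_apply, hzero, smul_zero] at hpos
  exact hpos.false

theorem mem_subfield_of_pos_eigenvector [DecidableEq n] [Nonempty n] {K : Subfield ℝ}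
    {M : Matrix n n K} (hM : (M.map K.subtype).IsPrimitive) {t : K} {x : n → ℝ}
    (hx : ∀ i, 0 < x i) (hMx : M.map K.subtype *ᵥ x = (t : ℝ) • x) (hsum : ∑ i, x i ∈ K) (i : n) :
    x i ∈ K := by
  have hx0 : x ≠ 0 := fun h => (hx i).ne' (congrFun h i)
  have hroot : M.charpoly.IsRoot t := by
    refine Polynomial.IsRoot.of_map (f := K.subtype) ?_ K.subtype_injective
    rw [← charpoly_map]
    exact exists_mulVec_eq_smul_iff_isRoot_charpoly.mp ⟨x, hx0, hMx⟩
  obtain ⟨v, hv, hMv⟩ := exists_mulVec_eq_smul_iff_isRoot_charpoly.mpr hroot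
  have hMw : M.map K.subtype *ᵥ (K.subtype ∘ v) = (t : ℝ) • (K.subtype ∘ v) := by
    ext j
    rw [← RingHom.map_mulVec, hMv]
    rfl
  obtain ⟨c, hc⟩ := eq_smul_of_mulVec_eq_smul hM hx hMx hMw
  have hvx (j : n) : (v j : ℝ) = c * x j := congrFun hc j
  have hc0 : c ≠ 0 := by
    rintro rfl
    exact hv (funext fun j => Subtype.ext ((hvx j).trans (zero_mul _)))
  have hcK : c ∈ K := by
    have hpos : 0 < ∑ j, x j := Finset.sum_pos (fun j _ => hx j) Finset.univ_nonempty
    rw [eq_div_of_mul_eq hpos.ne' (Finset.mul_sum _ x c)]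
    exact div_mem (sum_mem fun j _ => hvx j ▸ (v j).2) hsum
  rw [← mul_div_cancel_left₀ (x i) hc0, ← hvx]
  exact div_mem (v i).2 hcK

theorem norm_le_of_mulVec_le_smul {M : Matrix n n ℝ} (hM : ∀ i j, 0 ≤ M i j)
    {t : ℝ} {x : n → ℝ} (hx : ∀ i, 0 < x i) (hMx : M *ᵥ x ≤ t • x) {z : ℂ} {v : n → ℂ}
    (hv : v ≠ 0) (hMv : M.map (algebraMap ℝ ℂ) *ᵥ v = z • v) : ‖z‖ ≤ t := by
  obtain ⟨j, hj⟩ := Function.ne_iff.mp hv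
  have : Nonempty n := ⟨j⟩
  obtain ⟨i₀, hi₀⟩ := Finite.exists_max fun i => ‖v i‖ / x i
  set c := ‖v i₀‖ / x i₀
  have hvc : ∀ i, ‖v i‖ ≤ c * x i := fun i => (div_le_iff₀ (hx i)).mp (hi₀ i)
  have hc : 0 < c := pos_of_mul_pos_left ((norm_pos_iff.mpr hj).trans_le (hvc j)) (hx j).le
  have hvi₀ : ‖v i₀‖ = c * x i₀ := (div_mul_cancel₀ _ (hx i₀).ne').symm
  refine le_of_mul_le_mul_right ?_ (mul_pos hc (hx i₀))
  calc ‖z‖ * (c * x i₀) = ‖(z • v) i₀‖ := by rw [← hvi₀, Pi.smul_apply, smul_eq_mul, norm_mul]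
    _ = ‖∑ j, (M i₀ j : ℂ) * v j‖ := by rw [← hMv]; rfl
    _ ≤ ∑ j, M i₀ j * (c * x j) := by
      refine norm_sum_le_of_le _ fun j _ => ?_
      rw [norm_mul, Complex.norm_real, Real.norm_of_nonneg (hM _ _)]
      exact mul_le_mul_of_nonneg_left (hvc j) (hM _ _)
    _ = c * (M *ᵥ x) i₀ := by
      simp only [mulVec, dotProduct, Finset.mul_sum, mul_left_comm]
    _ ≤ c * (t * x i₀) := mul_le_mul_of_nonneg_left (hMx i₀) hc.le
    _ = t * (c * x i₀) := mul_left_comm _ _ _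

theorem nonneg_of_pos_eigenvector [Nonempty n] {M : Matrix n n ℝ} (hM : ∀ i j, 0 ≤ M i j)
    {t : ℝ} {x : n → ℝ} (hx : ∀ i, 0 < x i) (hMx : M *ᵥ x = t • x) : 0 ≤ t := by
  obtain ⟨i⟩ := ‹Nonempty n›
  have h : 0 ≤ (M *ᵥ x) i := Finset.sum_nonneg fun j _ => mul_nonneg (hM _ _) (hx j).le
  rw [hMx] at h
  exact nonneg_of_mul_nonneg_left h (hx i)

theorem spectralRadius_eq_of_pos_eigenvector [DecidableEq n] [Nonempty n] {M : Matrix n n ℝ}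
    (hM : ∀ i j, 0 ≤ M i j) {t : ℝ} {x : n → ℝ} (hx : ∀ i, 0 < x i) (hMx : M *ᵥ x = t • x) :
    spectralRadius ℂ (M.map (algebraMap ℝ ℂ)) = ENNReal.ofReal t := by
  have ht : 0 ≤ t := nonneg_of_pos_eigenvector hM hx hMx
  obtain ⟨i₀⟩ := ‹Nonempty n›
  have ht_mem : (t : ℂ) ∈ spectrum ℂ (M.map (algebraMap ℝ ℂ)) := by
    rw [mem_spectrum_iff_isRoot_charpoly, charpoly_map]
    exact (exists_mulVec_eq_smul_iff_isRoot_charpoly.mp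
      ⟨x, fun h => (hx i₀).ne' (congrFun h i₀), hMx⟩).map
  refine le_antisymm (iSup₂_le fun z hz => ?_) ?_
  · rw [mem_spectrum_iff_isRoot_charpoly, ← exists_mulVec_eq_smul_iff_isRoot_charpoly] at hz
    obtain ⟨v, hv, hMv⟩ := hz
    change ‖z‖ₑ ≤ _
    rw [← ofReal_norm]
    exact ENNReal.ofReal_le_ofReal (norm_le_of_mulVec_le_smul hM hx hMx.le hv hMv)
  · calc ENNReal.ofReal t = ‖(t : ℂ)‖ₑ := by
          rw [← ofReal_norm, Complex.norm_real, Real.norm_of_nonneg ht]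
      _ ≤ spectralRadius ℂ (M.map (algebraMap ℝ ℂ)) :=
          le_iSup₂ (f := fun z (_ : z ∈ spectrum ℂ (M.map (algebraMap ℝ ℂ))) => ‖z‖ₑ) _ ht_mem

/-- Subtracting from `B` the rank-one matrix with entries `e * x i` leaves a nonnegative matrix with
eigenvalue `t - e ∑ x` at `x`; this is the contraction factor of the width of the sandwich. -/
theorem exists_smul_le_mulVec_le_smul {B : Matrix n n ℝ} {e t : ℝ} {x : n → ℝ} (he : 0 ≤ e)
    (hB : ∀ i j, e * x i ≤ B i j) (hBx : B *ᵥ x = t • x) {v : n → ℝ} {c d : ℝ}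
    (hcv : c • x ≤ v) (hvd : v ≤ (c + d) • x) :
    ∃ c', t * c ≤ c' ∧ c' • x ≤ B *ᵥ v ∧ B *ᵥ v ≤ (c' + (t - e * ∑ i, x i) * d) • x := by
  set u := v - c • x with hu
  have hu0 : 0 ≤ u := sub_nonneg.mpr hcv
  have hud : u ≤ d • x := by rwa [hu, sub_le_iff_le_add', ← add_smul]
  set R : Matrix n n ℝ := B - vecMulVec (e • x) 1 with hR
  have hRmulVec (w : n → ℝ) : R *ᵥ w = B *ᵥ w - (e * ∑ i, w i) • x := by
    rw [hR, sub_mulVec, vecMulVec_mulVec, one_dotProduct, op_smul_eq_smul, smul_smul, mul_comm]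
  have hR0 : ∀ i j, 0 ≤ R i j := fun i j => by
    simpa [hR, vecMulVec_apply] using hB i j
  have hBv : B *ᵥ v = (t * c + e * ∑ i, u i) • x + R *ᵥ u := by
    rw [hRmulVec, hu, mulVec_sub, mulVec_smul, hBx]
    module
  refine ⟨t * c + e * ∑ i, u i, ?_, ?_, ?_⟩
  · exact le_add_of_nonneg_right (mul_nonneg he (Finset.sum_nonneg fun i _ => hu0 i))
  · rw [hBv]
    exact le_add_of_nonneg_right fun i => dotProduct_nonneg_of_nonneg (hR0 i) hu0
  · have hRu : R *ᵥ u ≤ R *ᵥ (d • x) := fun i =>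
      dotProduct_le_dotProduct_of_nonneg_left hud (hR0 i)
    rw [hBv, add_smul _ (_ * d)]
    refine add_le_add_right (hRu.trans_eq ?_) _
    rw [mulVec_smul, hRmulVec, hBx]
    module

theorem exists_smul_le_pow_mulVec_le_smul [DecidableEq n] {B : Matrix n n ℝ} {e t : ℝ} {x : n → ℝ}
    (he : 0 ≤ e) (ht : 0 ≤ t) (hB : ∀ i j, e * x i ≤ B i j) (hBx : B *ᵥ x = t • x)
    {v : n → ℝ} {c d : ℝ} (hcv : c • x ≤ v) (hvd : v ≤ (c + d) • x) (N : ℕ) :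
    ∃ c', t ^ N * c ≤ c' ∧ c' • x ≤ (B ^ N) *ᵥ v ∧
      (B ^ N) *ᵥ v ≤ (c' + (t - e * ∑ i, x i) ^ N * d) • x := by
  induction N with
  | zero => exact ⟨c, by simp, by simpa using hcv, by simpa using hvd⟩
  | succ N ih =>
    obtain ⟨c₁, hc₁, hlow, hupp⟩ := ih
    obtain ⟨c₂, hc₂, hlow', hupp'⟩ := exists_smul_le_mulVec_le_smul he hB hBx hlow hupp
    rw [mulVec_mulVec, ← pow_succ'] at hlow' hupp'
    rw [← mul_assoc, ← pow_succ'] at hupp'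
    refine ⟨c₂, ?_, hlow', hupp'⟩
    rw [pow_succ', mul_assoc]
    exact (mul_le_mul_of_nonneg_left hc₁ ht).trans hc₂

theorem eventually_pow_mul_lt_pow_mul {r t D E : ℝ} (hr : 0 ≤ r) (hrt : r < t) (hE : 0 < E) :
    ∀ᶠ N : ℕ in atTop, r ^ N * D < t ^ N * E := by
  have ht : 0 < t := hr.trans_lt hrt
  have hlim : Tendsto (fun N : ℕ => (r / t) ^ N * D) atTop (nhds (0 * D)) :=
    (tendsto_pow_atTop_nhds_zero_of_lt_one (div_nonneg hr ht.le)
      ((div_lt_one ht).mpr hrt)).mul_const D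
  rw [zero_mul] at hlim
  filter_upwards [hlim.eventually_lt_const hE] with N hN
  rwa [div_pow, div_mul_eq_mul_div, div_lt_iff₀' (pow_pos ht N)] at hN

theorem dotProduct_sub_le_dotProduct {x w h : n → ℝ} {c d : ℝ} (hcw : c • x ≤ w)
    (hwd : w ≤ (c + d) • x) : c * (h ⬝ᵥ x) - d * (|h| ⬝ᵥ x) ≤ h ⬝ᵥ w := by
  simp only [dotProduct, Finset.mul_sum, ← Finset.sum_sub_distrib]
  refine Finset.sum_le_sum fun i _ => ?_
  have hlow : 0 ≤ w i - c * x i := sub_nonneg.mpr (hcw i)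
  have hupp : w i - c * x i ≤ d * x i := by
    have := hwd i
    simp only [Pi.smul_apply, smul_eq_mul, add_mul] at this
    linarith
  have habs : |h i * (w i - c * x i)| ≤ |h i| * (d * x i) := by
    rw [abs_mul, abs_of_nonneg hlow]
    exact mul_le_mul_of_nonneg_left hupp (abs_nonneg _)
  have := (abs_le.mp habs).1
  simp only [Pi.abs_apply]
  linarith

theorem mul_sum_le_of_forall_mul_le [Nonempty n] {B : Matrix n n ℝ} {e t : ℝ} {x : n → ℝ}
    (hx : ∀ i, 0 < x i) (hB : ∀ i j, e * x i ≤ B i j) (hBx : B *ᵥ x = t • x) :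
    e * ∑ i, x i ≤ t := by
  obtain ⟨i⟩ := ‹Nonempty n›
  refine le_of_mul_le_mul_right ?_ (hx i)
  calc (e * ∑ j, x j) * x i = ∑ j, e * x i * x j := by rw [← Finset.mul_sum, mul_right_comm]
    _ ≤ ∑ j, B i j * x j :=
      Finset.sum_le_sum fun j _ => mul_le_mul_of_nonneg_right (hB i j) (hx j).le
    _ = t * x i := congrFun hBx i

theorem eventually_dotProduct_pow_mulVec_pos [DecidableEq n] {B : Matrix n n ℝ}
    (hB : ∀ i j, 0 < B i j) {t : ℝ} {x : n → ℝ} (hx : ∀ i, 0 < x i) (hBx : B *ᵥ x = t • x)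
    {h : n → ℝ} (hhx : 0 < h ⬝ᵥ x) {v : n → ℝ} (hv : ∀ i, 0 < v i) :
    ∀ᶠ N in atTop, 0 < h ⬝ᵥ ((B ^ N) *ᵥ v) := by
  have : Nonempty n := by
    by_contra hn
    rw [not_nonempty_iff] at hn
    simp at hhx
  obtain ⟨⟨i₀, j₀⟩, he⟩ := Finite.exists_min fun q : n × n => B q.1 q.2 / x q.1
  obtain ⟨i₁, hc⟩ := Finite.exists_min fun i => v i / x i
  obtain ⟨i₂, hd⟩ := Finite.exists_max fun i => v i / x i
  set e := B i₀ j₀ / x i₀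
  set c := v i₁ / x i₁
  set d := v i₂ / x i₂ - c
  have he0 : 0 < e := div_pos (hB _ _) (hx _)
  have hc0 : 0 < c := div_pos (hv _) (hx _)
  have heB : ∀ i j, e * x i ≤ B i j := fun i j => (le_div_iff₀ (hx i)).mp (he (i, j))
  have hcv : c • x ≤ v := fun i => (le_div_iff₀ (hx i)).mp (hc i)
  have hvd : v ≤ (c + d) • x := fun i => by
    simpa [d] using (div_le_iff₀ (hx i)).mp (hd i)
  have hsum : 0 < ∑ i, x i := Finset.sum_pos (fun i _ => hx i) Finset.univ_nonempty
  have hr0 : 0 ≤ t - e * ∑ i, x i := sub_nonneg.mpr (mul_sum_le_of_forall_mul_le hx heB hBx)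
  have hrt : t - e * ∑ i, x i < t := sub_lt_self t (mul_pos he0 hsum)
  filter_upwards [eventually_pow_mul_lt_pow_mul (D := d * (|h| ⬝ᵥ x)) hr0 hrt
    (mul_pos hc0 hhx)] with N hN
  obtain ⟨c', hc', hlow, hupp⟩ := exists_smul_le_pow_mulVec_le_smul he0.le (hr0.trans hrt.le)
    heB hBx hcv hvd N
  refine lt_of_lt_of_le (sub_pos.mpr ?_) (dotProduct_sub_le_dotProduct hlow hupp)
  rw [mul_assoc]
  refine hN.trans_le ?_
  rw [← mul_assoc]
  exact mul_le_mul_of_nonneg_right hc' hhx.le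

theorem exists_pos_entry_of_isPrimitive [DecidableEq n] {M : Matrix n n ℝ} (hM : M.IsPrimitive)
    (j : n) : ∃ i, 0 < M i j := by
  obtain ⟨hM0, m, hm0, hm⟩ := hM
  obtain ⟨m, rfl⟩ := Nat.exists_eq_add_of_lt hm0
  by_contra! hcol
  have := hm j j
  simp [pow_succ, mul_apply, fun i => (hcol i).antisymm (hM0 i j)] at this

theorem vecMul_pos_of_isPrimitive [DecidableEq n] {M : Matrix n n ℝ} (hM : M.IsPrimitive)
    {g : n → ℝ} (hg : ∀ i, 0 < g i) (j : n) : 0 < (g ᵥ* M) j := by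
  obtain ⟨i, hi⟩ := exists_pos_entry_of_isPrimitive hM j
  exact Finset.sum_pos' (fun k _ => mul_nonneg (hg k).le (hM.nonneg k j))
    ⟨i, Finset.mem_univ i, mul_pos (hg i) hi⟩

theorem eventually_vecMul_pow_pos [DecidableEq n] {M : Matrix n n ℝ} (hM : M.IsPrimitive)
    {t : ℝ} {x : n → ℝ} (hx : ∀ i, 0 < x i) (hMx : M *ᵥ x = t • x)
    {h : n → ℝ} (hhx : 0 < h ⬝ᵥ x) : ∀ᶠ N in atTop, ∀ j, 0 < (h ᵥ* M ^ N) j := by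
  obtain ⟨q, -, hq⟩ := hM.exists_pos_pow
  obtain ⟨N, hN⟩ := (eventually_all.mpr fun j => eventually_dotProduct_pow_mulVec_pos hq hx
    (pow_mulVec_of_mulVec_eq_smul hMx q) hhx (v := fun i => (M ^ q) i j) fun i => hq i j).exists
  refine eventually_atTop.mpr ⟨q * N + q, fun K hK => ?_⟩
  induction K, hK using Nat.le_induction with
  | base =>
    intro j
    rw [pow_add, pow_mul, ← vecMul_vecMul]
    exact (dotProduct_mulVec h _ _).subst (motive := fun r => 0 < r) (hN j)
  | succ K _ ih =>
    rw [pow_succ, ← vecMul_vecMul]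
    exact vecMul_pos_of_isPrimitive hM ih

end PerronFrobenius

/-! ### Integer combinations -/

section Combination

variable {ι κ G : Type*} [AddCommGroup G] [Fintype κ]

theorem exists_coeff_pos_of_linearIndependent {x : ι → G} {y : κ → G}
    (hy : LinearIndependent ℤ y) {D : ι → κ → ℕ} (hD : ∀ j, x j = ∑ l, D j l • y l) {l : κ}
    (hl : y l ∈ AddSubgroup.closure (Set.range x)) : ∃ j, 0 < D j l := by
  by_contra! hzero
  have hx : ∀ j, x j ∈ Submodule.span ℤ (y '' {l}ᶜ) := fun j => by
    rw [hD j]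
    refine sum_mem fun i _ => ?_
    obtain rfl | hi := eq_or_ne i l
    · simp [Nat.le_zero.mp (hzero j)]
    · exact nsmul_mem (Submodule.subset_span (Set.mem_image_of_mem y hi)) _
  refine hy.notMem_span_image (s := {l}ᶜ) (x := l) (by simp) ?_
  exact (AddSubgroup.closure_le (Submodule.span ℤ (y '' {l}ᶜ)).toAddSubgroup).mpr
    (Set.range_subset_iff.mpr hx) hl

theorem sum_update_zsmul_update_sub [DecidableEq κ] (z : κ → G) (a : κ → ℤ) {u v : κ}
    (huv : u ≠ v) :
    ∑ l, Function.update a v (a v + a u) l • Function.update z u (z u - z v) l =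
      ∑ l, a l • z l := by
  rw [← sub_eq_zero, ← Finset.sum_sub_distrib,
    Finset.sum_eq_add_of_mem u v (Finset.mem_univ _) (Finset.mem_univ _) huv]
  · simp only [Function.update_self, Function.update_of_ne huv, Function.update_of_ne huv.symm]
    module
  · intro l _ hl
    simp only [Function.update_of_ne hl.1, Function.update_of_ne hl.2, sub_self]

theorem card_filter_update_lt [DecidableEq κ] {α : Type*} {p : α → Prop} [DecidablePred p]
    {a : κ → α} {i : κ} {c : α} (hi : p (a i)) (hc : ¬p c) :
    Finset.card {l | p (Function.update a i c l)} < Finset.card {l | p (a l)} := by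
  refine Finset.card_lt_card (Finset.ssubset_iff_of_subset ?_ |>.mpr ⟨i, by simpa, by simpa⟩)
  refine Finset.monotone_filter_right _ fun l _ hl => ?_
  obtain rfl | hli := eq_or_ne l i
  · exact hi
  · rwa [Function.update_of_ne hli] at hl

end Combination

/-! ### Positive refinements -/

section PositiveRefinement

variable {ι κ μ G : Type*} [AddCommGroup G] [PartialOrder G]

/-- `y` is a positive refinement of `z` if `y` consists of positive elements, every `z i` is a
sum of elements of `y`, and `y` stays in the group generated by `z`. Both families then generate
the same group. -/
structure PositiveRefinement (y : κ → G) (z : ι → G) : Prop where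
  pos : ∀ i, 0 < y i
  mem_addSubmonoid : ∀ i, z i ∈ AddSubmonoid.closure (Set.range y)
  mem_addSubgroup : ∀ i, y i ∈ AddSubgroup.closure (Set.range z)

namespace PositiveRefinement

theorem refl {z : ι → G} (hz : ∀ i, 0 < z i) : PositiveRefinement z z where
  pos := hz
  mem_addSubmonoid i := AddSubmonoid.subset_closure ⟨i, rfl⟩
  mem_addSubgroup i := AddSubgroup.subset_closure ⟨i, rfl⟩

theorem trans {x : μ → G} {y : κ → G} {z : ι → G} (hxy : PositiveRefinement x y)
    (hyz : PositiveRefinement y z) : PositiveRefinement x z where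
  pos := hxy.pos
  mem_addSubmonoid i := AddSubmonoid.closure_le.mpr (Set.range_subset_iff.mpr
    hxy.mem_addSubmonoid) (hyz.mem_addSubmonoid i)
  mem_addSubgroup i := (AddSubgroup.closure_le _).mpr (Set.range_subset_iff.mpr
    hyz.mem_addSubgroup) (hxy.mem_addSubgroup i)

theorem closure_eq {y : κ → G} {z : ι → G} (h : PositiveRefinement y z) :
    AddSubgroup.closure (Set.range y) = AddSubgroup.closure (Set.range z) := by
  refine le_antisymm ((AddSubgroup.closure_le _).mpr (Set.range_subset_iff.mpr
    h.mem_addSubgroup)) ((AddSubgroup.closure_le _).mpr (Set.range_subset_iff.mpr fun i => ?_))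
  exact AddSubmonoid.closure_le (S := (AddSubgroup.closure _).toAddSubmonoid).mpr
    AddSubgroup.subset_closure (h.mem_addSubmonoid i)

theorem comp_succAbove {n : ℕ} {z : Fin (n + 1) → G} (hz : ∀ i, 0 < z i) {i j : Fin (n + 1)}
    (hij : i ≠ j) (h : z i = z j) : PositiveRefinement (z ∘ i.succAbove) z where
  pos l := hz _
  mem_addSubmonoid l := by
    have hne {l : Fin (n + 1)} (hl : l ≠ i) :
        z l ∈ AddSubmonoid.closure (Set.range (z ∘ i.succAbove)) := by
      obtain ⟨m, rfl⟩ := Fin.exists_succAbove_eq hl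
      exact AddSubmonoid.subset_closure ⟨m, rfl⟩
    obtain rfl | hl := eq_or_ne l i
    · exact h ▸ hne hij.symm
    · exact hne hl
  mem_addSubgroup l := AddSubgroup.subset_closure ⟨_, rfl⟩

theorem update_sub [IsOrderedAddMonoid G] [DecidableEq ι] {z : ι → G} (hz : ∀ i, 0 < z i)
    {u v : ι} (huv : z v < z u) :
    PositiveRefinement (Function.update z u (z u - z v)) z where
  pos l := by
    obtain rfl | hl := eq_or_ne l u
    · simpa using huv
    · simpa [Function.update_of_ne hl] using hz l
  mem_addSubmonoid l := by
    have hmem (i : ι) : Function.update z u (z u - z v) i ∈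
        AddSubmonoid.closure (Set.range (Function.update z u (z u - z v))) :=
      AddSubmonoid.subset_closure ⟨i, rfl⟩
    obtain rfl | hl := eq_or_ne l u
    · have hne : v ≠ l := fun h => huv.ne (congrArg z h)
      simpa [Function.update_of_ne hne] using add_mem (hmem l) (hmem v)
    · simpa [Function.update_of_ne hl] using hmem l
  mem_addSubgroup l := by
    have hmem (i : ι) : z i ∈ AddSubgroup.closure (Set.range z) :=
      AddSubgroup.subset_closure ⟨i, rfl⟩
    obtain rfl | hl := eq_or_ne l u
    · simpa using sub_mem (hmem l) (hmem v)
    · simpa [Function.update_of_ne hl] using hmem l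

end PositiveRefinement

theorem exists_neg_of_sum_zsmul_eq_zero [IsOrderedAddMonoid G] [Fintype ι] {z : ι → G}
    (hz : ∀ i, 0 < z i) {a : ι → ℤ} (hrel : ∑ l, a l • z l = 0) {j : ι} (hj : 0 < a j) :
    ∃ i, a i < 0 := by
  by_contra! hnonneg
  have hpos : 0 < ∑ l, a l • z l :=
    Finset.sum_pos' (fun l _ => zsmul_nonneg (hz l).le (hnonneg l))
      ⟨j, Finset.mem_univ j, zsmul_pos (hz j) hj⟩
  exact hpos.ne' hrel

end PositiveRefinement

section LinearOrder

variable {G : Type*} [AddCommGroup G] [LinearOrder G] [IsOrderedAddMonoid G] {n : ℕ}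

/-- Subtracting the smaller of two members `z i`, `z j` with `a i < 0` and `a j = M` from the
larger one adds the coefficient of the larger one to that of the smaller one, which moves it into
`[0, M)`. This happens at most once per index. -/
theorem exists_positiveRefinement_or_lt {m M : ℤ} (hm : 0 ≤ m) (hmM : m ≤ M) (hM : 0 < M)
    {z : Fin (n + 1) → G} (hz : ∀ i, 0 < z i) {a : Fin (n + 1) → ℤ} (ha : a ≠ 0)
    (hrel : ∑ l, a l • z l = 0) (hlow : ∀ l, -m ≤ a l) (hupp : ∀ l, a l ≤ M) :
    (∃ y : Fin n → G, PositiveRefinement y z) ∨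
      ∃ (z' : Fin (n + 1) → G) (b : Fin (n + 1) → ℤ), PositiveRefinement z' z ∧ b ≠ 0 ∧
        ∑ l, b l • z' l = 0 ∧ ∀ l, -m ≤ b l ∧ b l < M := by
  induction hcard : Finset.card {l | a l < 0 ∨ a l = M} using Nat.strong_induction_on
    generalizing z a with
  | h c ih =>
  by_cases hmax : ∃ j, a j = M
  swap
  · push Not at hmax
    exact .inr ⟨z, a, .refl hz, ha, hrel, fun l => ⟨hlow l, (hupp l).lt_of_ne (hmax l)⟩⟩
  obtain ⟨j, hj⟩ := hmax
  obtain ⟨i, hi⟩ := exists_neg_of_sum_zsmul_eq_zero hz hrel (hj ▸ hM)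
  have hij : i ≠ j := by rintro rfl; omega
  obtain heq | hne := eq_or_ne (z i) (z j)
  · exact .inl ⟨_, .comp_succAbove hz hij heq⟩
  obtain ⟨u, v, huv, hu, hv, hv0, hvM⟩ : ∃ u v, z v < z u ∧ a u ≠ 0 ∧ (a v < 0 ∨ a v = M) ∧
      0 ≤ a v + a u ∧ a v + a u < M := by
    have := hlow i
    obtain hlt | hlt := hne.lt_or_gt
    · exact ⟨j, i, hlt, by omega, .inl hi, by omega, by omega⟩
    · exact ⟨i, j, hlt, hi.ne, .inr hj, by omega, by omega⟩
  have huv' : u ≠ v := fun h => huv.ne' (congrArg z h)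
  set b := Function.update a v (a v + a u)
  have hbv : b v = a v + a u := Function.update_self ..
  have hbl {l} (hl : l ≠ v) : b l = a l := Function.update_of_ne hl ..
  have hbound (l) : -m ≤ b l ∧ b l ≤ M := by
    obtain rfl | hl := eq_or_ne l v
    · omega
    · exact hbl hl ▸ ⟨hlow l, hupp l⟩
  have hlt : Finset.card {l | b l < 0 ∨ b l = M} < c :=
    hcard ▸ card_filter_update_lt (p := fun k => k < 0 ∨ k = M) hv (by omega)
  have href := PositiveRefinement.update_sub hz huv
  obtain ⟨y, hy⟩ | ⟨z', b', hz', hb'⟩ := ih _ hlt href.pos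
    (fun h => hu ((hbl huv').symm.trans (congrFun h u)))
    ((sum_update_zsmul_update_sub z a huv').trans hrel) (fun l => (hbound l).1)
    (fun l => (hbound l).2) rfl
  · exact .inl ⟨y, hy.trans href⟩
  · exact .inr ⟨z', b', hz'.trans href, hb'⟩

theorem exists_positiveRefinement_of_sum_zsmul_eq_zero {z : Fin (n + 1) → G}
    (hz : ∀ i, 0 < z i) {a : Fin (n + 1) → ℤ} (ha : a ≠ 0) (hrel : ∑ l, a l • z l = 0) :
    ∃ y : Fin n → G, PositiveRefinement y z := by
  obtain ⟨m, M, hbound⟩ : ∃ m M : ℕ, ∀ l, -(m : ℤ) ≤ a l ∧ a l ≤ M := by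
    have habs (l) : |a l| ≤ ((∑ l, (a l).natAbs : ℕ) : ℤ) := by
      rw [Int.abs_eq_natAbs]
      exact_mod_cast Finset.single_le_sum_of_canonicallyOrdered (f := fun l => (a l).natAbs)
        (Finset.mem_univ l)
    exact ⟨_, _, fun l => abs_le.mp (habs l)⟩
  induction hN : m + M using Nat.strong_induction_on generalizing m M z a with
  | h N ih =>
  wlog hmM : m ≤ M generalizing a m M
  · exact this (neg_ne_zero.mpr ha) (by simpa using hrel) M m
      (fun l => ⟨neg_le_neg (hbound l).2, neg_le.mp (hbound l).1⟩) (by omega) (by omega)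
  have hM : 0 < M := by
    refine Nat.pos_of_ne_zero fun h => ha (funext fun l => ?_)
    have := hbound l
    rw [Pi.zero_apply]
    omega
  obtain hy | ⟨z', b, hz', hb, hrel', hb'⟩ := exists_positiveRefinement_or_lt
    (Nat.cast_nonneg m) (Nat.cast_le.mpr hmM) (Nat.cast_pos.mpr hM) hz ha hrel
    (fun l => (hbound l).1) (fun l => (hbound l).2)
  · exact hy
  · obtain ⟨y, hy⟩ := ih (m + (M - 1)) (by omega) hz'.pos hb hrel' m (M - 1)
      (fun l => by have := hb' l; omega) rfl
    exact ⟨y, hy.trans hz'⟩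

theorem exists_linearIndependent_positiveRefinement {z : Fin n → G} (hz : ∀ i, 0 < z i) :
    ∃ (m : ℕ) (y : Fin m → G), PositiveRefinement y z ∧ LinearIndependent ℤ y := by
  induction n with
  | zero => exact ⟨0, z, .refl hz, linearIndependent_empty_type⟩
  | succ n ih =>
    by_cases hli : LinearIndependent ℤ z
    · exact ⟨n + 1, z, .refl hz, hli⟩
    obtain ⟨a, hrel, i, hi⟩ := Fintype.not_linearIndependent_iff.mp hli
    obtain ⟨z', hz'⟩ := exists_positiveRefinement_of_sum_zsmul_eq_zero hz
      (fun h => hi (congrFun h i)) hrel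
    obtain ⟨m, y, hy, hyli⟩ := ih hz'.pos
    exact ⟨m, y, hy.trans hz', hyli⟩

end LinearOrder

/-! ### Stable subspaces of a field extension -/

section StableSubspace

open IntermediateField Module

variable {K L : Type*} [Field K] [Field L] [Algebra K L]

theorem finrank_map_mulLeft {t : L} (ht : t ≠ 0) (V : Submodule K L) :
    finrank K (V.map (LinearMap.mulLeft K t)) = finrank K V :=
  (Submodule.equivMapOfInjective _ (mul_right_injective₀ ht) V).finrank_eq.symm

theorem finrank_span_smul {t : L} (ht : t ≠ 0) (s : Set L) :
    finrank K (Submodule.span K (t • s)) = finrank K (Submodule.span K s) := by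
  rw [← finrank_map_mulLeft ht (Submodule.span K s), Submodule.map_span]
  rfl

theorem pow_mul_mem_of_mul_mem {V : Submodule K L} {t : L} (hmul : ∀ v ∈ V, t * v ∈ V) {v : L}
    (hv : v ∈ V) (N : ℕ) : t ^ N * v ∈ V := by
  induction N with
  | zero => simpa using hv
  | succ N ih => rw [pow_succ', mul_assoc]; exact hmul _ ih

theorem mem_of_mul_mem {V : Submodule K L} [FiniteDimensional K V] {t : L} (ht : t ≠ 0)
    (hmul : ∀ v ∈ V, t * v ∈ V) {u : L} (hu : t * u ∈ V) : u ∈ V := by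
  have hmap : V.map (LinearMap.mulLeft K t) = V :=
    Submodule.eq_of_le_of_finrank_eq (Submodule.map_le_iff_le_comap.mpr hmul)
      (finrank_map_mulLeft ht V)
  obtain ⟨w, hw, hwu⟩ := hmap.ge hu
  exact mul_left_cancel₀ ht hwu ▸ hw

theorem finrank_eq_natDegree_minpoly {t : L} (ht : IsIntegral K t) {V : Submodule K L}
    (hV : V ≠ ⊥) (hmul : ∀ v ∈ V, t * v ∈ V) (hle : ∀ v ∈ V, v ∈ K⟮t⟯) :
    finrank K V = (minpoly K t).natDegree := by
  obtain ⟨v, hv, hv0⟩ := V.ne_bot_iff.mp hV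
  have : FiniteDimensional K K⟮t⟯ := adjoin.finiteDimensional ht
  have hle' : V ≤ Subalgebra.toSubmodule K⟮t⟯.toSubalgebra := hle
  refine le_antisymm ?_ ?_
  · rw [← adjoin.finrank ht]
    exact Submodule.finrank_mono hle'
  · have hli : LinearIndependent K fun j : Fin (minpoly K t).natDegree =>
        (⟨t ^ (j : ℕ) * v, pow_mul_mem_of_mul_mem hmul hv j⟩ : V) :=
      .of_comp V.subtype ((linearIndependent_pow t).map' (LinearMap.mulRight K v)
        (LinearMap.ker_eq_bot.mpr (mul_left_injective₀ hv0)))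
    have : FiniteDimensional K V := Submodule.finiteDimensional_of_le hle'
    simpa using hli.fintype_card_le_finrank

end StableSubspace

/-! ### Perron–Frobenius eigenvectors of integer matrices -/

section PerronVector

open IntermediateField Module

variable {s : ℕ} {A : Matrix (Fin s) (Fin s) ℕ} {x : Fin s → ℝ}

theorem perronRoot_eq_of_pos_eigenvector [Nonempty (Fin s)] {t : ℝ} (hx : ∀ i, 0 < x i)
    (hAx : A.map (fun n : ℕ => (n : ℝ)) *ᵥ x = t • x) : perronRoot A = t := by
  have hA : ∀ i j, 0 ≤ A.map (fun n : ℕ => (n : ℝ)) i j := fun _ _ => Nat.cast_nonneg _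
  have hmap : A.map (fun n : ℕ => (n : ℂ)) =
      (A.map fun n : ℕ => (n : ℝ)).map (algebraMap ℝ ℂ) := by
    ext; simp
  rw [perronRoot, hmap, spectralRadius_eq_of_pos_eigenvector hA hx hAx,
    ENNReal.toReal_ofReal (nonneg_of_pos_eigenvector hA hx hAx)]

theorem perronRoot_of_isEmpty [IsEmpty (Fin s)] : perronRoot A = 0 := by
  have : Subsingleton (Matrix (Fin s) (Fin s) ℂ) := inferInstance
  simp [perronRoot, spectralRadius, spectrum.of_subsingleton]

theorem isNormalizedPerronVector_inv_sum_smul [Nonempty (Fin s)] {t : ℝ} (hx : ∀ i, 0 < x i)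
    (hAx : A.map (fun n : ℕ => (n : ℝ)) *ᵥ x = t • x) :
    IsNormalizedPerronVector A ((∑ i, x i)⁻¹ • x) := by
  have hsum : 0 < ∑ i, x i := Finset.sum_pos (fun i _ => hx i) Finset.univ_nonempty
  refine ⟨fun i => mul_pos (inv_pos.mpr hsum) (hx i), ?_, ?_⟩
  · rw [perronRoot_eq_of_pos_eigenvector hx hAx, mulVec_smul, hAx, smul_comm]
  · simp only [Pi.smul_apply, smul_eq_mul, ← Finset.mul_sum]
    exact inv_mul_cancel₀ hsum.ne'

theorem Primitive.exists_isNormalizedPerronVector [Nonempty (Fin s)] (hA : Primitive A) :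
    ∃ x, IsNormalizedPerronVector A x := by
  obtain ⟨t, x, hx, -, hAx⟩ := exists_pos_eigenvector hA
  exact ⟨_, isNormalizedPerronVector_inv_sum_smul hx hAx⟩

theorem primitive_of_forall_pos (hA : ∀ i j, 0 < A i j) : Primitive A :=
  ⟨fun _ _ => Nat.cast_nonneg _, 1, one_pos, fun i j => by simpa using hA i j⟩

theorem apply_mem_H (x : Fin s → ℝ) (i : Fin s) : x i ∈ H x :=
  AddSubgroup.subset_closure ⟨i, rfl⟩

theorem span_H (x : Fin s → ℝ) :
    Submodule.span ℚ (H x : Set ℝ) = Submodule.span ℚ (Set.range x) :=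
  le_antisymm (Submodule.span_le.mpr ((AddSubgroup.closure_le
    (Submodule.span ℚ (Set.range x)).toAddSubgroup).mpr Submodule.subset_span))
    (Submodule.span_mono AddSubgroup.subset_closure)

theorem mem_H_smul_iff {c : ℝ} (hc : c ≠ 0) {u : ℝ} : u ∈ H (c • x) ↔ c⁻¹ * u ∈ H x := by
  have hmap : H (c • x) = (H x).map (AddMonoidHom.mulLeft c) := by
    rw [H, H, AddMonoidHom.map_closure, ← Set.range_comp]
    rfl
  rw [hmap, AddSubgroup.mem_map]
  constructor
  · rintro ⟨v, hv, rfl⟩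
    simpa [hc] using hv
  · exact fun hu => ⟨_, hu, by simp [hc]⟩

theorem exists_isNormalizedPerronVector_of_mem_S {u : ℝ} (hu : u ∈ S A) :
    ∃ x, IsNormalizedPerronVector A x := by
  simp only [S, Set.mem_iUnion] at hu
  obtain ⟨x, hx, -⟩ := hu
  exact ⟨x, hx⟩

namespace IsNormalizedPerronVector

theorem nonempty (hx : IsNormalizedPerronVector A x) : Nonempty (Fin s) := by
  by_contra hempty
  rw [not_nonempty_iff] at hempty
  simpa using hx.sum_eq_one

theorem unique (hA : Primitive A) (hx : IsNormalizedPerronVector A x) {y : Fin s → ℝ}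
    (hy : IsNormalizedPerronVector A y) : y = x := by
  have := hx.nonempty
  obtain ⟨c, rfl⟩ := eq_smul_of_mulVec_eq_smul hA hx.pos hx.eigen hy.eigen
  have hc := hy.sum_eq_one
  simp only [Pi.smul_apply, smul_eq_mul, ← Finset.mul_sum, hx.sum_eq_one, mul_one] at hc
  rw [hc, one_smul]

theorem perronRoot_pos (hA : Primitive A) (hx : IsNormalizedPerronVector A x) :
    0 < perronRoot A := by
  obtain ⟨i⟩ := hx.nonempty
  obtain ⟨-, m, hm, hpos⟩ := hA
  have hpow := mulVec_pos_of_pos hpos (fun j => (hx.pos j).le)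
    (fun h => (hx.pos i).ne' (congrFun h i)) i
  rw [pow_mulVec_of_mulVec_eq_smul hx.eigen] at hpow
  refine ENNReal.toReal_nonneg.lt_of_ne' fun h0 => ?_
  simp [perronRoot, h0, hm.ne'] at hpow

theorem mul_mem_H (hx : IsNormalizedPerronVector A x) {u : ℝ} (hu : u ∈ H x) :
    perronRoot A * u ∈ H x := by
  suffices hle : H x ≤ (H x).comap (AddMonoidHom.mulLeft (perronRoot A)) from hle hu
  refine (AddSubgroup.closure_le _).mpr (Set.range_subset_iff.mpr fun i => ?_)
  have heigen : ∑ j, A i j • x j = perronRoot A * x i := by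
    simpa [mulVec, dotProduct] using congrFun hx.eigen i
  change perronRoot A * x i ∈ H x
  exact heigen ▸ sum_mem fun j _ => nsmul_mem (apply_mem_H x j) _

theorem pow_mul_mem_H (hx : IsNormalizedPerronVector A x) {u : ℝ} (hu : u ∈ H x) (N : ℕ) :
    perronRoot A ^ N * u ∈ H x := by
  induction N with
  | zero => simpa using hu
  | succ N ih => rw [pow_succ', mul_assoc]; exact hx.mul_mem_H ih

theorem mem_S_iff (hA : Primitive A) (hx : IsNormalizedPerronVector A x) {u : ℝ} :
    u ∈ S A ↔ ∃ N : ℕ, perronRoot A ^ N * u ∈ H x := by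
  have hpow (N : ℕ) : u ∈ (1 / perronRoot A ^ N) • (H x : Set ℝ) ↔ perronRoot A ^ N * u ∈ H x := by
    have hne : 1 / perronRoot A ^ N ≠ 0 :=
      one_div_ne_zero (pow_ne_zero N (hx.perronRoot_pos hA).ne')
    rw [Set.mem_smul_set_iff_inv_smul_mem₀ hne, one_div, inv_inv, smul_eq_mul, SetLike.mem_coe]
  simp only [S, Set.mem_iUnion, ← hpow]
  constructor
  · rintro ⟨y, hy, hu⟩
    exact hx.unique hA hy ▸ hu
  · exact fun hu => ⟨x, hx, hu⟩

theorem apply_mem_S (hA : Primitive A) (hx : IsNormalizedPerronVector A x) (i : Fin s) :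
    x i ∈ S A :=
  (hx.mem_S_iff hA).mpr ⟨0, by simpa using apply_mem_H x i⟩

theorem apply_mem_adjoin (hA : Primitive A) (hx : IsNormalizedPerronVector A x) (i : Fin s) :
    x i ∈ ℚ⟮perronRoot A⟯ := by
  have := hx.nonempty
  let K := ℚ⟮perronRoot A⟯.toSubfield
  have hmap : (A.map fun n : ℕ => (n : K)).map K.subtype = A.map fun n : ℕ => (n : ℝ) := rfl
  exact mem_subfield_of_pos_eigenvector (K := K) (M := A.map fun n : ℕ => (n : K))
    (t := ⟨perronRoot A, mem_adjoin_simple_self ℚ _⟩) (hmap ▸ hA) hx.pos (hmap ▸ hx.eigen)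
    (hx.sum_eq_one ▸ one_mem K) i

theorem isIntegral_perronRoot (hx : IsNormalizedPerronVector A x) :
    IsIntegral ℚ (perronRoot A) := by
  obtain ⟨i⟩ := hx.nonempty
  have hmap : (A.map fun n : ℕ => (n : ℚ)).map (algebraMap ℚ ℝ) = A.map fun n : ℕ => (n : ℝ) := by
    ext; simp
  refine ⟨(A.map fun n : ℕ => (n : ℚ)).charpoly, Matrix.charpoly_monic _, ?_⟩
  rw [← Polynomial.eval_map, ← charpoly_map, hmap]
  exact exists_mulVec_eq_smul_iff_isRoot_charpoly.mp
    ⟨x, fun h => (hx.pos i).ne' (congrFun h i), hx.eigen⟩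

theorem mul_mem_span (hx : IsNormalizedPerronVector A x) {u : ℝ}
    (hu : u ∈ Submodule.span ℚ (Set.range x)) :
    perronRoot A * u ∈ Submodule.span ℚ (Set.range x) := by
  rw [← span_H] at hu ⊢
  suffices hle : Submodule.span ℚ (H x : Set ℝ) ≤
    (Submodule.span ℚ (H x)).comap (LinearMap.mulLeft ℚ (perronRoot A)) from hle hu
  exact Submodule.span_le.mpr fun v hv => Submodule.subset_span (hx.mul_mem_H hv)

theorem span_S (hA : Primitive A) (hx : IsNormalizedPerronVector A x) :
    Submodule.span ℚ (S A) = Submodule.span ℚ (Set.range x) := by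
  refine le_antisymm (Submodule.span_le.mpr fun u hu => ?_)
    (Submodule.span_mono (Set.range_subset_iff.mpr (hx.apply_mem_S hA)))
  obtain ⟨N, hN⟩ := (hx.mem_S_iff hA).mp hu
  have := FiniteDimensional.span_of_finite ℚ (Set.finite_range x)
  refine mem_of_mul_mem (pow_ne_zero N (hx.perronRoot_pos hA).ne')
    (fun v hv => pow_mul_mem_of_mul_mem (fun _ => hx.mul_mem_span) hv N) ?_
  rw [← span_H]
  exact Submodule.subset_span hN

theorem finrank_span_range (hA : Primitive A) (hx : IsNormalizedPerronVector A x) :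
    finrank ℚ (Submodule.span ℚ (Set.range x)) = (minpoly ℚ (perronRoot A)).natDegree := by
  obtain ⟨i⟩ := hx.nonempty
  refine finrank_eq_natDegree_minpoly hx.isIntegral_perronRoot ?_ (fun _ => hx.mul_mem_span) ?_
  · exact (Submodule.ne_bot_iff _).mpr ⟨x i, Submodule.subset_span ⟨i, rfl⟩, (hx.pos i).ne'⟩
  · exact Submodule.span_le (p := Subalgebra.toSubmodule ℚ⟮perronRoot A⟯.toSubalgebra) |>.mpr
      (Set.range_subset_iff.mpr (hx.apply_mem_adjoin hA))

theorem mem_adjoin_of_mem_H (hA : Primitive A) (hx : IsNormalizedPerronVector A x) {u : ℝ}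
    (hu : u ∈ H x) : u ∈ ℚ⟮perronRoot A⟯ :=
  (AddSubgroup.closure_le ℚ⟮perronRoot A⟯.toSubfield.toSubring.toAddSubgroup).mpr
    (Set.range_subset_iff.mpr (hx.apply_mem_adjoin hA)) hu

theorem card_eq_natDegree_minpoly (hA : Primitive A) (hx : IsNormalizedPerronVector A x) {m : ℕ}
    {y : Fin m → ℝ} (hy : LinearIndependent ℤ y) (hH : H y = H x) :
    m = (minpoly ℚ (perronRoot A)).natDegree := by
  have hyQ : LinearIndependent ℚ y := (LinearIndependent.iff_fractionRing ℤ ℚ).mp hy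
  rw [← hx.finrank_span_range hA, ← span_H, ← hH, span_H, finrank_span_eq_card hyQ,
    Fintype.card_fin]

theorem eventually_exists_pos_combination (hA : Primitive A) (hx : IsNormalizedPerronVector A x)
    {u : ℝ} (hu : u ∈ H x) (hu0 : 0 < u) :
    ∀ᶠ N in atTop, ∃ p : Fin s → ℕ, (∀ j, 0 < p j) ∧ ∑ j, p j • x j = perronRoot A ^ N * u := by
  obtain ⟨c, rfl⟩ := AddSubgroup.exists_of_mem_closure_range x u hu
  have hcx : (fun j => (c j : ℝ)) ⬝ᵥ x = ∑ j, c j • x j := by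
    simp only [dotProduct, zsmul_eq_mul]
  have hpos := eventually_vecMul_pow_pos hA hx.pos hx.eigen (hcx ▸ hu0)
  filter_upwards [hpos] with N hN
  set p : Fin s → ℤ := c ᵥ* (A.map fun n : ℕ => (n : ℤ)) ^ N
  have hp (j) : (p j : ℝ) = ((fun j => (c j : ℝ)) ᵥ* (A.map fun n : ℕ => (n : ℝ)) ^ N) j := by
    have hpow : ((A.map fun n : ℕ => (n : ℤ)) ^ N).map (Int.castRingHom ℝ) =
        (A.map fun n : ℕ => (n : ℝ)) ^ N := by
      rw [← RingHom.mapMatrix_apply, map_pow]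
      congr 1
    rw [← hpow]
    exact RingHom.map_vecMul (Int.castRingHom ℝ) _ c j
  have hp0 (j) : 0 < p j := by exact_mod_cast hp j ▸ hN j
  refine ⟨fun j => (p j).toNat, fun j => by simpa using hp0 j, ?_⟩
  calc ∑ j, (p j).toNat • x j
      = ((fun j => (c j : ℝ)) ᵥ* (A.map fun n : ℕ => (n : ℝ)) ^ N) ⬝ᵥ x := by
        refine Finset.sum_congr rfl fun j _ => ?_
        rw [← hp, ← natCast_zsmul, Int.toNat_of_nonneg (hp0 j).le, zsmul_eq_mul]
    _ = perronRoot A ^ N * ∑ j, c j • x j := by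
      rw [← dotProduct_mulVec, pow_mulVec_of_mulVec_eq_smul hx.eigen, dotProduct_smul, hcx,
        smul_eq_mul]

theorem exists_pos_matrix_of_positiveRefinement (hA : Primitive A)
    (hx : IsNormalizedPerronVector A x) {m : ℕ} {y : Fin m → ℝ} (hyx : PositiveRefinement y x)
    (hy : LinearIndependent ℤ y) :
    ∃ e > 0, ∃ B : Matrix (Fin m) (Fin m) ℕ, (∀ i l, 0 < B i l) ∧
      B.map (fun n : ℕ => (n : ℝ)) *ᵥ y = perronRoot A ^ e • y := by
  choose D hD using fun j =>
    AddSubmonoid.exists_of_mem_closure_range y (x j) (hyx.mem_addSubmonoid j)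
  obtain ⟨e, hp, he⟩ := ((eventually_all.mpr fun i => hx.eventually_exists_pos_combination hA
    (hyx.mem_addSubgroup i) (hyx.pos i)).and (eventually_gt_atTop 0)).exists
  choose p hp0 hpx using hp
  refine ⟨e, he, of p * of D, fun i l => ?_, funext fun i => ?_⟩
  · obtain ⟨j, hj⟩ := exists_coeff_pos_of_linearIndependent hy hD (hyx.mem_addSubgroup l)
    exact Finset.sum_pos' (fun _ _ => Nat.zero_le _)
      ⟨j, Finset.mem_univ j, Nat.mul_pos (hp0 i j) hj⟩
  · calc ((of p * of D).map (fun n : ℕ => (n : ℝ)) *ᵥ y) i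
        = ∑ j, p i j • ∑ l, D j l • y l := by
          have hmul : (of p * of D).map (fun n : ℕ => (n : ℝ)) =
              (of p).map (fun n : ℕ => (n : ℝ)) * (of D).map (fun n : ℕ => (n : ℝ)) :=
            Matrix.map_mul (f := Nat.castRingHom ℝ)
          rw [hmul, ← mulVec_mulVec]
          simp only [mulVec, dotProduct, map_apply, of_apply, nsmul_eq_mul]
      _ = perronRoot A ^ e * y i := by simp only [← hD, hpx]

theorem S_eq_smul_S (hA : Primitive A) (hx : IsNormalizedPerronVector A x) {m : ℕ}
    {B : Matrix (Fin m) (Fin m) ℕ} (hB : Primitive B) {y : Fin m → ℝ} {α : ℝ} (hα : α ≠ 0)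
    (hy : IsNormalizedPerronVector B (α • y)) (hH : H y = H x) {e : ℕ} (he : 0 < e)
    (hBA : perronRoot B = perronRoot A ^ e) : S B = α • S A := by
  ext u
  have hstep (N : ℕ) : perronRoot B ^ N * u ∈ H (α • y) ↔
      perronRoot A ^ (e * N) * (α⁻¹ * u) ∈ H x := by
    rw [mem_H_smul_iff hα, hH, hBA, ← pow_mul, mul_left_comm]
  rw [hy.mem_S_iff hB, Set.mem_smul_set_iff_inv_smul_mem₀ hα, smul_eq_mul, hx.mem_S_iff hA]
  simp only [hstep]
  refine ⟨fun ⟨N, hN⟩ => ⟨e * N, hN⟩, fun ⟨N, hN⟩ => ⟨N, ?_⟩⟩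
  have hpow := hx.pow_mul_mem_H hN (e * N - N)
  rwa [← mul_assoc, ← pow_add, Nat.sub_add_cancel (Nat.le_mul_of_pos_left N he)] at hpow

end IsNormalizedPerronVector

theorem finrank_span_S [Nonempty (Fin s)] (hA : Primitive A) :
    finrank ℚ (Submodule.span ℚ (S A)) = (minpoly ℚ (perronRoot A)).natDegree := by
  obtain ⟨x, hx⟩ := hA.exists_isNormalizedPerronVector
  rw [hx.span_S hA, hx.finrank_span_range hA]

theorem natDegree_minpoly_le_of_S_eq_smul_S [Nonempty (Fin s)] (hA : Primitive A) {l : ℕ}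
    {P : Matrix (Fin l) (Fin l) ℕ} (hP : Primitive P) {α : ℝ} (h : S P = α • S A) :
    (minpoly ℚ (perronRoot A)).natDegree ≤ l := by
  obtain ⟨x, hx⟩ := hA.exists_isNormalizedPerronVector
  obtain ⟨i⟩ := hx.nonempty
  have hmem : α * x i ∈ S P := h ▸ Set.smul_mem_smul_set (hx.apply_mem_S hA i)
  obtain ⟨y, hy⟩ := exists_isNormalizedPerronVector_of_mem_S hmem
  obtain ⟨j⟩ := hy.nonempty
  have hα : α ≠ 0 := by
    rintro rfl
    obtain ⟨v, -, hv⟩ := h ▸ hy.apply_mem_S hP j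
    exact (hy.pos j).ne ((zero_mul v).symm.trans hv)
  calc (minpoly ℚ (perronRoot A)).natDegree
      = finrank ℚ (Submodule.span ℚ (S P)) := by rw [h, finrank_span_smul hα, finrank_span_S hA]
    _ = finrank ℚ (Submodule.span ℚ (Set.range y)) := by rw [hy.span_S hP]
    _ ≤ l := (finrank_range_le_card y).trans_eq (Fintype.card_fin l)

theorem pos_of_two_le_natDegree_minpoly (h : 2 ≤ (minpoly ℚ (perronRoot A)).natDegree) :
    0 < s := by
  refine Nat.pos_of_ne_zero ?_
  rintro rfl
  rw [perronRoot_of_isEmpty, minpoly.zero, Polynomial.natDegree_X] at h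
  omega

end PerronVector

end PerronClopen

open PerronClopen in
theorem mainTheorem4_general (s : ℕ) (hs : 0 < s) (A : Matrix (Fin s) (Fin s) ℕ)
    (hA : Primitive A) (k : ℕ) (hdeg : (minpoly ℚ (perronRoot A)).natDegree = k) :
    (∃ A' : Matrix (Fin k) (Fin k) ℕ, Primitive A' ∧
      ∃ α : ℝ, α ∈ IntermediateField.adjoin ℚ {perronRoot A} ∧ 0 < α ∧ S A' = α • S A) ∧
    (∀ (l : ℕ) (P : Matrix (Fin l) (Fin l) ℕ), Primitive P →
      ∀ α : ℝ, S P = α • S A → k ≤ l) := by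
  have : Nonempty (Fin s) := Fin.pos_iff_nonempty.mp hs
  refine ⟨?_, fun l P hP α h => hdeg ▸ natDegree_minpoly_le_of_S_eq_smul_S hA hP h⟩
  obtain ⟨x, hx⟩ := hA.exists_isNormalizedPerronVector
  obtain ⟨m, y, hyx, hy⟩ := exists_linearIndependent_positiveRefinement hx.pos
  have hH : H y = H x := hyx.closure_eq
  obtain rfl : m = k := (hx.card_eq_natDegree_minpoly hA hy hH).trans hdeg
  have : Nonempty (Fin m) :=
    Fin.pos_iff_nonempty.mp (hdeg ▸ minpoly.natDegree_pos hx.isIntegral_perronRoot)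
  obtain ⟨e, he, B, hB, hBy⟩ := hx.exists_pos_matrix_of_positiveRefinement hA hyx hy
  have hBprim : Primitive B := primitive_of_forall_pos hB
  have hα : 0 < (∑ i, y i)⁻¹ :=
    inv_pos.mpr (Finset.sum_pos (fun i _ => hyx.pos i) Finset.univ_nonempty)
  refine ⟨B, hBprim, (∑ i, y i)⁻¹, inv_mem (sum_mem fun i _ =>
    hx.mem_adjoin_of_mem_H hA (hyx.mem_addSubgroup i)), hα, ?_⟩
  exact hx.S_eq_smul_S hA hBprim hα.ne' (isNormalizedPerronVector_inv_sum_smul hyx.pos hBy) hH he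
    (perronRoot_eq_of_pos_eigenvector hyx.pos hBy)

theorem mainTheorem4 (s : ℕ) (A : Matrix (Fin s) (Fin s) ℕ) (hA : PerronClopen.Primitive A)
    (k : ℕ) (hk : 2 ≤ k) (hdeg : (minpoly ℚ (PerronClopen.perronRoot A)).natDegree = k) :
    (∃ A' : Matrix (Fin k) (Fin k) ℕ, PerronClopen.Primitive A' ∧
      ∃ α : ℝ, α ∈ IntermediateField.adjoin ℚ {PerronClopen.perronRoot A} ∧ 0 < α ∧
        PerronClopen.S A' = α • PerronClopen.S A) ∧
    (∀ (l : ℕ) (P : Matrix (Fin l) (Fin l) ℕ), PerronClopen.Primitive P →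
      ∀ α : ℝ, PerronClopen.S P = α • PerronClopen.S A → k ≤ l) :=
  mainTheorem4_general s (PerronClopen.pos_of_two_le_natDegree_minpoly (hdeg ▸ hk)) A hA k hdeg
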